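/- Let $\mathscr C$ be an extension closed variety of finite groups, i.e. a nonempty class of finite groups closed under subgroups, finite direct products, homomorphic images and group extensions. A pro-$\mathscr C$ group is a profinite group all of whose quotients by open normal subgroups belong to $\mathscr C$. A family of continuous homomorphisms $\iota_\alpha\colon \Gamma_\alpha\to\Gamma$ $(\alpha\in A)$ of pro-$\mathscr C$ groups is \emph{convergent} if every open neighborhood of $1$ in $\Gamma$ contains $\iota_\alpha(\Gamma_\alpha)$ for all but finitely many $\alpha\in A$. The pro-$\mathscr C$ group $\Gamma$, together with a convergent family $(\iota_\alpha)_{\alpha\in A}$ as above, is the \emph{free pro-$\mathscr C$ product} $\coprod_{\alpha\in A}\Gamma_\alpha$ if for every pro-$\mathscr C$ group $K$ and every convergent family of continuous homomorphisms $\lambda_\alpha\colon\Gamma_\alpha\to K$ there is a unique continuous homomorphism $\lambda\colon\Gamma\to K$ with $\lambda\iota_\alpha=\lambda_\alpha$ for all $\alpha\in A$. A pro-$\mathscr C$ group $\Phi$ is a \emph{free pro-$\mathscr C$ group of finite rank} if there are a finite set $Z$ and a map $b\colon Z\to\Phi$ such that for every pro-$\mathscr C$ group $K$ and every map $\sigma\colon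 Z\to K$ there is a unique continuous homomorphism $\psi\colon\Phi\to K$ with $\psi b=\sigma$. \textbf{Theorem.} Let $\Gamma=\coprod_{\alpha\in A}\Gamma_\alpha$ be a free pro-$\mathscr C$ product of pro-$\mathscr C$ groups indexed by a set $A$, let $H$ be an open subgroup of $\Gamma$, and write $\Gamma_\alpha$ also for the subgroup $\iota_\alpha(\Gamma_\alpha)$ of $\Gamma$. Then for each $\alpha\in A$ there exists a set $D_\alpha\subseteq\Gamma$ of representatives of the double cosets $H\backslash\Gamma/\Gamma_\alpha$ such that the family of inclusions $$\{\,u\Gamma_\alpha u^{-1}\cap H\hookrightarrow H \mid \alpha\in A,\ u\in D_\alpha\,\}$$ converges, and there is a subgroup $\Phi\le H$ which is a free pro-$\mathscr C$ group of finite rank such that $H$ is the free pro-$\mathscr C$ product $$H=\Bigl[\coprod_{\alpha\in A,\,u\in D_\alpha}\bigl(u\Gamma_\alpha u^{-1}\cap H\bigr)\Bigr]\amalg\Phi ,$$ that is: some subgroup $P\le H$ containing all the groups $u\Gamma_\alpha u^{-1}\cap H$ is, together with the inclusions, their free pro-$\mathscr C$ product, and $H$ is, together with the inclusions, the free pro-$\mathscr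 C$ product of $P$ and $\Phi$. -/

import Mathlib

universe u v

namespace ProC

/-- An extension closed variety of finite groups: a nonempty class of finite groups closed under
subgroups, finite direct products, homomorphic images and extensions. (The empty product, i.e. the
trivial group, belongs to the class because the class is nonempty and closed under subgroups.) -/
structure IsExtensionClosedVariety (C : ∀ (G : Type u) [Group G], Prop) : Prop where
  finite : ∀ (G : Type u) [Group G], C G → Finite G
  nonempty : ∃ (G : Type u) (_ : Group G), C G
  subgroup : ∀ (G : Type u) [Group G] (H : Subgroup G), C G → C H
  prod : ∀ (G H : Type u) [Group G] [Group H], C G → C H → C (G × H)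
  image : ∀ (G H : Type u) [Group G] [Group H] (f : G →* H),
    Function.Surjective f → C G → C H
  extension : ∀ (G : Type u) [Group G] (N : Subgroup G) [N.Normal], C N → C (G ⧸ N) → C G

/-- A pro-`C` group: a profinite group all of whose quotients by open normal subgroups belong
to `C`. -/
structure IsProC (C : ∀ (G : Type u) [Group G], Prop)
    (G : Type u) [Group G] [TopologicalSpace G] : Prop where
  isTopologicalGroup : IsTopologicalGroup G
  compactSpace : CompactSpace G
  t2Space : T2Space G
  totallyDisconnectedSpace : TotallyDisconnectedSpace G
  quotient_mem : ∀ (N : Subgroup G) [N.Normal], IsOpen (N : Set G) → C (G ⧸ N)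

/-- A family of continuous homomorphisms into `G` is convergent if every open neighbourhood of `1`
contains the images of all but finitely many members of the family. -/
def IsConvergent {I : Type v} {X : I → Type u} [∀ i, Group (X i)] [∀ i, TopologicalSpace (X i)]
    {G : Type u} [Group G] [TopologicalSpace G] (f : ∀ i, X i →ₜ* G) : Prop :=
  ∀ U : Set G, IsOpen U → (1 : G) ∈ U → {i | ¬ Set.range (f i) ⊆ U}.Finite

/-- The pro-`C` group `G`, together with the convergent family `f`, is the free pro-`C` product of
the pro-`C` groups `X i`. -/
structure IsFreeProduct (C : ∀ (G : Type u) [Group G], Prop)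
    {I : Type v} {X : I → Type u} [∀ i, Group (X i)] [∀ i, TopologicalSpace (X i)]
    {G : Type u} [Group G] [TopologicalSpace G] (f : ∀ i, X i →ₜ* G) : Prop where
  isProC : IsProC C G
  isProC_factor : ∀ i, IsProC C (X i)
  convergent : IsConvergent f
  existsUnique_lift : ∀ (K : Type u) [Group K] [TopologicalSpace K], IsProC C K →
    ∀ g : ∀ i, X i →ₜ* K, IsConvergent g → ∃! l : G →ₜ* K, ∀ i x, l (f i x) = g i x

/-- The pro-`C` group `F`, together with the continuous map `b : X → F`, is a free pro-`C` group on
the space `X`. -/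
structure IsFreeOn (C : ∀ (G : Type u) [Group G], Prop)
    {X : Type v} [TopologicalSpace X] {F : Type u} [Group F] [TopologicalSpace F]
    (b : X → F) : Prop where
  isProC : IsProC C F
  continuous : Continuous b
  existsUnique_lift : ∀ (K : Type u) [Group K] [TopologicalSpace K], IsProC C K →
    ∀ s : X → K, Continuous s → ∃! l : F →ₜ* K, ∀ x, l (b x) = s x

/-- `F` is a free pro-`C` group of finite rank: it is free pro-`C` on a finite (discrete) set. -/
def IsFreeOfFiniteRank (C : ∀ (G : Type u) [Group G], Prop)
    (F : Type u) [Group F] [TopologicalSpace F] : Prop :=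
  ∃ (n : ℕ) (b : Fin n → F), IsFreeOn C b

section Subgroups

variable {G : Type u} [Group G]

/-- `D` is a set of representatives of the double cosets `H \ G / K`: every double coset contains
exactly one element of `D`. -/
def IsDoubleCosetReps (H K : Subgroup G) (D : Set G) : Prop :=
  ∀ g : G, ∃! u, u ∈ D ∧ u ∈ DoubleCoset.doubleCoset g (H : Set G) (K : Set G)

/-- The subgroup `u K u⁻¹ ∩ H`. -/
def conjInter (H K : Subgroup G) (u : G) : Subgroup G :=
  K.map (MulAut.conj u).toMonoidHom ⊓ H

theorem conjInter_le (H K : Subgroup G) (u : G) : conjInter H K u ≤ H := inf_le_right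

variable [TopologicalSpace G]

/-- The inclusion between subgroups, as a continuous homomorphism for the subspace topologies. -/
def inclusion {S H : Subgroup G} (h : S ≤ H) : S →ₜ* H where
  toMonoidHom := Subgroup.inclusion h
  continuous_toFun := continuous_inclusion h

/-- The subgroups `S i` are contained in `H`, and `H` together with the inclusions `S i → H` is
their free pro-`C` product. -/
def IsInternalFreeProduct (C : ∀ (G : Type u) [Group G], Prop)
    {I : Type v} (H : Subgroup G) (S : I → Subgroup G) : Prop :=
  ∃ h : ∀ i, S i ≤ H, IsFreeProduct C (fun i => inclusion (h i))

end Subgroups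

end ProC

namespace ProC

/-! ### Varieties of finite groups and pro-`C` groups. -/

section Classes

variable {C : ∀ (G : Type u) [Group G], Prop}

/-! Write `E = G ⧸ H`, a finite set since `H` is open. Continuous homomorphisms `H → K` are studied
through continuous cocycles `c : G × E → K`, i.e. sections of `(E → K) ⋊ G → G`: restricting `c` at
the trivial coset gives a homomorphism on `H`, and coset representatives turn a homomorphism on `H`
into a cocycle. The semidirect product is again pro-`C` (`IsProC.cocycleGroup`; this uses extension
closure), so the universal property of `G` applies to it: a cocycle on `G` amounts to a convergent
family of cocycles on the factors `X a`.

On each `X a`-orbit in `E`, a cocycle amounts to a homomorphism on the stabilizer of a base point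
together with free values on elements moving the base point to the other points. The stabilizers,
conjugated by coset representatives, are the groups `u Γ_a u⁻¹ ∩ H`. Choosing the representatives
along a tree (`SchreierSystem`) normalizes the cocycle to be trivial on tree edges; the remaining
free values are carried by the elements `loop a x` of `H`. Only finitely many of these are
nontrivial, because almost all factors act trivially on `E`.

Thus `H` has the joint universal property of the conjugate intersections and finitely many free
generators: `SchreierSystem.hom_ext` is uniqueness, `SchreierSystem.exists_lift` existence, and
`exists_isInternalFreeProduct` splits this into `P` and `Φ`. -/

theorem IsExtensionClosedVariety.of_ker_le (hC : IsExtensionClosedVariety C)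
    {S G T : Type u} [Group S] [Group G] [Group T] (hG : C G) (φ : S →* G) (ψ : S →* T)
    (hψ : Function.Surjective ψ) (h : φ.ker ≤ ψ.ker) : C T := by
  have hr : φ.rangeRestrict.ker ≤ ψ.ker := by rwa [MonoidHom.ker_rangeRestrict]
  -- `T` is a homomorphic image of the subgroup `φ.range` of `G`.
  refine hC.image φ.range T
    (φ.rangeRestrict.liftOfSurjective φ.rangeRestrict_surjective ⟨ψ, hr⟩) ?_
    (hC.subgroup G φ.range hG)
  intro t
  obtain ⟨s, rfl⟩ := hψ t
  exact ⟨φ.rangeRestrict s, MonoidHom.liftOfRightInverse_comp_apply _ _ _ ⟨ψ, hr⟩ s⟩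

theorem IsExtensionClosedVariety.pi (hC : IsExtensionClosedVariety C)
    {E : Type u} [Finite E] {K : Type u} [Group K] (hK : C K) : C (E → K) := by
  induction E using Finite.induction_empty_option with
  | @of_equiv α β e h =>
    let ψ : (α → K) →* (β → K) :=
      { toFun := fun f b => f (e.symm b), map_one' := rfl, map_mul' := fun _ _ => rfl }
    exact hC.image _ _ ψ (fun f => ⟨fun a => f (e a), by funext b; simp [ψ]⟩) h
  | h_empty =>
    exact hC.of_ker_le hK (1 : (PEmpty → K) →* K) (MonoidHom.id _) Function.surjective_id
      fun x _ => Subsingleton.elim _ _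
  | @h_option α _ h =>
    let ψ : K × (α → K) →* (Option α → K) :=
      { toFun := fun p o => o.elim p.1 p.2
        map_one' := by funext o; cases o <;> rfl
        map_mul' := fun p q => by funext o; cases o <;> rfl }
    exact hC.image _ _ ψ (fun f => ⟨(f none, fun a => f (some a)), by funext o; cases o <;> rfl⟩)
      (hC.prod _ _ hK h)

theorem IsProC.exists_openNormalSubgroup {G : Type u} [Group G] [TopologicalSpace G]
    (hG : IsProC C G) {U : Set G} (hU : IsOpen U) (h1 : (1 : G) ∈ U) :
    ∃ N : Subgroup G, N.Normal ∧ IsOpen (N : Set G) ∧ (N : Set G) ⊆ U := by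
  have := hG.isTopologicalGroup
  have := hG.compactSpace
  have := hG.t2Space
  have := hG.totallyDisconnectedSpace
  obtain ⟨N, hN⟩ := ProfiniteGrp.exist_openNormalSubgroup_sub_open_nhds_of_one hU h1
  exact ⟨N.toSubgroup, N.isNormal', N.isOpen', hN⟩

theorem IsProC.of_isClosed (hC : IsExtensionClosedVariety C) {G : Type u} [Group G]
    [TopologicalSpace G] (hG : IsProC C G) {S : Subgroup G} (hS : IsClosed (S : Set G)) :
    IsProC C S := by
  have := hG.isTopologicalGroup
  have := hG.compactSpace
  have := hG.t2Space
  have := hG.totallyDisconnectedSpace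
  refine ⟨inferInstance, isCompact_iff_compactSpace.mp hS.isCompact, inferInstance,
    inferInstance, fun M hM hMo => ?_⟩
  obtain ⟨U, hU, hUM⟩ := isOpen_induced_iff.mp hMo
  have h1 : (1 : G) ∈ U := by
    have : (1 : S) ∈ Subtype.val ⁻¹' U := by rw [hUM]; exact M.one_mem
    exact this
  obtain ⟨N, hN, hNo, hNU⟩ := hG.exists_openNormalSubgroup hU h1
  refine hC.of_ker_le (hG.quotient_mem N hNo) ((QuotientGroup.mk' N).comp S.subtype)
    (QuotientGroup.mk' M) (QuotientGroup.mk'_surjective M) fun x hx => ?_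
  rw [QuotientGroup.ker_mk', ← SetLike.mem_coe, ← hUM]
  rw [MonoidHom.mem_ker, MonoidHom.comp_apply, QuotientGroup.mk'_apply,
    QuotientGroup.eq_one_iff] at hx
  exact hNU hx

end Classes

/-! ### The semidirect product classifying cocycles. -/

/-- The semidirect product of `E → K` with `G`, where `G` acts on the arguments: its continuous
homomorphic sections over `G` are the continuous `1`-cocycles `G × E → K`. -/
def CocycleGroup (E K G : Type*) := (E → K) × G

namespace CocycleGroup

variable {E K G : Type*}

instance [TopologicalSpace K] [TopologicalSpace G] : TopologicalSpace (CocycleGroup E K G) :=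
  inferInstanceAs (TopologicalSpace ((E → K) × G))

instance [TopologicalSpace K] [TopologicalSpace G] [CompactSpace K] [CompactSpace G] :
    CompactSpace (CocycleGroup E K G) :=
  inferInstanceAs (CompactSpace ((E → K) × G))

instance [TopologicalSpace K] [TopologicalSpace G] [T2Space K] [T2Space G] :
    T2Space (CocycleGroup E K G) :=
  inferInstanceAs (T2Space ((E → K) × G))

instance [TopologicalSpace K] [TopologicalSpace G] [TotallyDisconnectedSpace K]
    [TotallyDisconnectedSpace G] : TotallyDisconnectedSpace (CocycleGroup E K G) :=
  inferInstanceAs (TotallyDisconnectedSpace ((E → K) × G))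

/-- As `E` is discrete, `e` is locally constant, so locally this is evaluation at a fixed point. -/
theorem continuous_eval [TopologicalSpace E] [DiscreteTopology E] [TopologicalSpace K]
    {Y : Type*} [TopologicalSpace Y] {f : Y → E → K} {e : Y → E}
    (hf : Continuous f) (he : Continuous e) : Continuous fun y => f y (e y) := by
  refine continuous_iff_continuousAt.mpr fun y => ?_
  have h : ∀ᶠ z in nhds y, e z = e y := 
    he.continuousAt.eventually (p := fun z => z = e y) (by simp)
  refine (((continuous_apply (e y)).comp hf).continuousAt (x := y)).congr ?_
  filter_upwards [h] with z hz
  simp [hz]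

variable [Group K] [Group G] [MulAction G E]

instance : Group (CocycleGroup E K G) where
  mul p q := (fun x => p.1 (q.2 • x) * q.1 x, p.2 * q.2)
  one := (1, 1)
  inv p := (fun x => (p.1 (p.2⁻¹ • x))⁻¹, p.2⁻¹)
  mul_assoc p q r := by
    refine Prod.ext (funext fun x => ?_) (mul_assoc _ _ _)
    change p.1 (q.2 • r.2 • x) * q.1 (r.2 • x) * r.1 x = p.1 ((q.2 * r.2) • x) * (_ * _)
    rw [mul_smul, mul_assoc]
  one_mul p := Prod.ext (funext fun x => one_mul _) (one_mul _)
  mul_one p := by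
    refine Prod.ext (funext fun x => ?_) (mul_one _)
    change p.1 ((1 : G) • x) * 1 = p.1 x
    rw [one_smul, mul_one]
  inv_mul_cancel p := by
    refine Prod.ext (funext fun x => ?_) (inv_mul_cancel _)
    change (p.1 (p.2⁻¹ • p.2 • x))⁻¹ * p.1 x = 1
    rw [inv_smul_smul, inv_mul_cancel]

theorem mul_fst (p q : CocycleGroup E K G) (x : E) : (p * q).1 x = p.1 (q.2 • x) * q.1 x := rfl

theorem one_fst (x : E) : (1 : CocycleGroup E K G).1 x = 1 := rfl

/-- The inclusion of the kernel of the projection to `G`. -/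
def inl : (E → K) →* CocycleGroup E K G where
  toFun f := (f, 1)
  map_one' := rfl
  map_mul' f f' := by
    refine Prod.ext (funext fun x => ?_) (mul_one _).symm
    change f x * f' x = f ((1 : G) • x) * f' x
    rw [one_smul]

/-- The trivial section of the projection to `G`. -/
def inr : G →* CocycleGroup E K G where
  toFun g := (1, g)
  map_one' := rfl
  map_mul' _ _ := Prod.ext (funext fun _ => (mul_one _).symm) rfl

/-- The projection to `G`. -/
def snd : CocycleGroup E K G →* G where
  toFun := Prod.snd
  map_one' := rfl
  map_mul' _ _ := rfl

theorem inr_mul_inl (p : CocycleGroup E K G) : inr p.2 * inl p.1 = p :=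
  Prod.ext (funext fun _ => one_mul _) (mul_one _)

variable [TopologicalSpace K] [TopologicalSpace G]

theorem continuous_inl : Continuous (inl : (E → K) →* CocycleGroup E K G) :=
  Continuous.prodMk continuous_id continuous_const

theorem continuous_inr : Continuous (inr : G →* CocycleGroup E K G) :=
  Continuous.prodMk continuous_const continuous_id

theorem continuous_snd : Continuous (snd : CocycleGroup E K G →* G) := _root_.continuous_snd

variable [TopologicalSpace E] [DiscreteTopology E] [ContinuousSMul G E]
  [IsTopologicalGroup K] [IsTopologicalGroup G]

instance : IsTopologicalGroup (CocycleGroup E K G) where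
  continuous_mul := by
    have h1 : Continuous fun p : ((E → K) × G) × ((E → K) × G) => p.1.1 := by fun_prop
    refine Continuous.prodMk (continuous_pi fun x => Continuous.mul ?_ ?_) ?_
    · exact continuous_eval h1 (e := fun p : ((E → K) × G) × ((E → K) × G) => p.2.2 • x)
        (by fun_prop)
    · exact (continuous_apply x).comp (_root_.continuous_fst.comp _root_.continuous_snd)
    · exact Continuous.mul (_root_.continuous_snd.comp _root_.continuous_fst)
        (_root_.continuous_snd.comp _root_.continuous_snd)
  continuous_inv := by
    have h1 : Continuous fun p : (E → K) × G => p.1 := by fun_prop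
    refine Continuous.prodMk (continuous_pi fun x => Continuous.inv ?_) ?_
    · exact continuous_eval h1 (e := fun p : (E → K) × G => p.2⁻¹ • x) (by fun_prop)
    · exact Continuous.inv _root_.continuous_snd

end CocycleGroup

section

variable {C : ∀ (G : Type u) [Group G], Prop}

theorem exists_isOpen_pi_subset {E K : Type*} [Finite E] [One K] [TopologicalSpace K]
    {U : Set (E → K)} (hU : IsOpen U) (h1 : (1 : E → K) ∈ U) :
    ∃ V : Set K, IsOpen V ∧ (1 : K) ∈ V ∧ ∀ f : E → K, (∀ x, f x ∈ V) → f ∈ U := by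
  obtain ⟨I, V, hV, hVU⟩ := isOpen_pi_iff.mp hU _ h1
  exact ⟨⋂ x ∈ I, V x, isOpen_biInter_finset fun x hx => (hV x hx).1,
    Set.mem_iInter₂.mpr fun x hx => (hV x hx).2,
    fun f hf => hVU fun x hx => Set.mem_iInter₂.mp (hf x) x hx⟩

-- A quotient by an open normal `M` is an extension of the image of `E → K` by a quotient of `G`.
-- The first is a quotient of some `E → K ⧸ N`, since `M` contains all functions with values in a
-- small open normal `N`; the second is a quotient of `G` by the open subgroup `M ∩ G`.
open CocycleGroup in
theorem IsProC.cocycleGroup (hC : IsExtensionClosedVariety C) {E K G : Type u} [Group K] [Group G]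
    [MulAction G E] [TopologicalSpace K] [TopologicalSpace G] [TopologicalSpace E]
    [DiscreteTopology E] [ContinuousSMul G E] [Finite E] (hK : IsProC C K) (hG : IsProC C G) :
    IsProC C (CocycleGroup E K G) := by
  have := hG.isTopologicalGroup
  have := hG.compactSpace
  have := hG.t2Space
  have := hG.totallyDisconnectedSpace
  have := hK.isTopologicalGroup
  have := hK.compactSpace
  have := hK.t2Space
  have := hK.totallyDisconnectedSpace
  refine ⟨inferInstance, inferInstance, inferInstance, inferInstance, fun M hM hMo => ?_⟩
  let π := QuotientGroup.mk' M
  let j : (E → K) →* CocycleGroup E K G ⧸ M := π.comp inl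
  have hj : j.range = (snd (E := E) (K := K) (G := G)).ker.map π := by
    rw [MonoidHom.range_comp]
    congr 1
    ext p
    constructor
    · rintro ⟨f, rfl⟩; rfl
    · intro hp; exact ⟨p.1, Prod.ext rfl (Eq.symm hp)⟩
  have : j.range.Normal := by
    rw [hj]; exact Subgroup.Normal.map inferInstance π (QuotientGroup.mk'_surjective M)
  refine hC.extension _ j.range ?_ ?_
  · have hU : IsOpen ((inl : (E → K) →* CocycleGroup E K G) ⁻¹' M) := hMo.preimage CocycleGroup.continuous_inl
    have h1 : (1 : E → K) ∈ (inl : (E → K) →* CocycleGroup E K G) ⁻¹' M := M.one_mem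
    obtain ⟨V, hV, hV1, hVU⟩ := exists_isOpen_pi_subset hU h1
    obtain ⟨N, hN, hNo, hNV⟩ := hK.exists_openNormalSubgroup hV hV1
    refine hC.of_ker_le (hC.pi (E := E) (hK.quotient_mem N hNo))
      ((QuotientGroup.mk' N).compLeft E) j.rangeRestrict j.rangeRestrict_surjective ?_
    intro f hf
    rw [MonoidHom.ker_rangeRestrict]
    exact (QuotientGroup.eq_one_iff _).mpr
      (hVU f fun x => hNV ((QuotientGroup.eq_one_iff _).mp (congrFun hf x)))
  · let ψ : G →* (CocycleGroup E K G ⧸ M) ⧸ j.range := (QuotientGroup.mk' j.range).comp (π.comp inr)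
    have hn : (M.comap (inr : G →* CocycleGroup E K G)).Normal := inferInstance
    refine hC.of_ker_le (hG.quotient_mem (M.comap (inr : G →* CocycleGroup E K G))
      (hMo.preimage CocycleGroup.continuous_inr)) (QuotientGroup.mk' _) ψ ?_ ?_
    · intro q
      obtain ⟨p, rfl⟩ := ((QuotientGroup.mk'_surjective j.range).comp
        (QuotientGroup.mk'_surjective M)) q
      refine ⟨p.2, ?_⟩
      refine QuotientGroup.eq.mpr ⟨p.1, ?_⟩
      change π (inl p.1) = (π (inr p.2))⁻¹ * π p
      rw [← map_inv, ← map_mul]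
      congr 1
      rw [eq_inv_mul_iff_mul_eq]
      exact inr_mul_inl p
    · intro g hg
      rw [QuotientGroup.ker_mk'] at hg
      have : π (inr g) = 1 := (QuotientGroup.eq_one_iff _).mpr hg
      change QuotientGroup.mk' j.range (π (inr g)) = 1
      rw [this, map_one]

end

/-! ### Topological generation by the factors. -/

section Generation

variable {C : ∀ (G : Type u) [Group G], Prop} {A : Type v} {X : A → Type u} [∀ a, Group (X a)]
  [∀ a, TopologicalSpace (X a)] {G : Type u} [Group G] [TopologicalSpace G]

theorem IsConvergent.comp {K : Type u} [Group K] [TopologicalSpace K] {f : ∀ a, X a →ₜ* G}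
    (hf : IsConvergent f) (l : G →ₜ* K) : IsConvergent fun a => l.comp (f a) := by
  intro U hU h1
  refine (hf (l ⁻¹' U) (hU.preimage l.continuous_toFun) (by simpa using h1)).subset ?_
  intro a ha h
  refine ha ?_
  rintro _ ⟨x, rfl⟩
  exact h ⟨x, rfl⟩

/-- Two continuous homomorphisms out of a free product agree if they agree on the factors. -/
theorem IsFreeProduct.hom_ext {f : ∀ a, X a →ₜ* G} (hf : IsFreeProduct C f) {K : Type u} [Group K]
    [TopologicalSpace K] (hK : IsProC C K) {l l' : G →ₜ* K}
    (h : ∀ a x, l (f a x) = l' (f a x)) : l = l' :=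
  (hf.existsUnique_lift K hK (fun a => l'.comp (f a)) (hf.convergent.comp l')).unique h
    fun _ _ => rfl

/-- A free product is topologically generated by its factors. -/
theorem IsFreeProduct.eq_top_of_isClosed (hC : IsExtensionClosedVariety C)
    {f : ∀ a, X a →ₜ* G} (hf : IsFreeProduct C f) {S : Subgroup G} (hS : IsClosed (S : Set G))
    (h : ∀ a x, f a x ∈ S) : S = ⊤ := by
  let g : ∀ a, X a →ₜ* S := fun a =>
    { toMonoidHom := (f a).toMonoidHom.codRestrict S (h a)
      continuous_toFun := (f a).continuous_toFun.subtype_mk _ }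
  have hg : IsConvergent g := by
    intro U hU h1
    obtain ⟨V, hV, rfl⟩ := isOpen_induced_iff.mp hU
    refine (hf.convergent V hV h1).subset fun a ha hr => ha ?_
    rintro _ ⟨x, rfl⟩
    exact hr ⟨x, rfl⟩
  obtain ⟨l, hl, -⟩ := hf.existsUnique_lift S (hf.isProC.of_isClosed hC hS) g hg
  let i : S →ₜ* G := { toMonoidHom := S.subtype, continuous_toFun := continuous_subtype_val }
  -- The lift into `S`, followed by the inclusion, fixes the factors, so it is the identity and `S`
  -- is everything.
  have : i.comp l = ContinuousMonoidHom.id G := hf.hom_ext hf.isProC fun a x => by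
    change ((l (f a x) : S) : G) = f a x
    rw [hl]; rfl
  refine eq_top_iff.mpr fun x _ => ?_
  have hx : i (l x) = x := DFunLike.congr_fun this x
  rw [← hx]
  exact (l x).2

end Generation

/-! ### Schreier systems of coset representatives. -/

section Schreier

variable {A : Type v} {X : A → Type u} [∀ a, Group (X a)] [∀ a, TopologicalSpace (X a)]
  {G : Type u} [Group G] [TopologicalSpace G]

/-- Compatible choices for the action of the groups `X a` on the coset space `G ⧸ H`: a base point
`base a x` in the `X a`-orbit of each point `x`, an element `move a x` of `X a` that moves it
to `x`, and a coset representative `rep x` of each point `x`, built up from the trivial one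
along a tree. -/
structure SchreierSystem (ι : ∀ a, X a →ₜ* G) (H : Subgroup G) where
  base : A → G ⧸ H → G ⧸ H
  base_smul : ∀ a g x, base a (ι a g • x) = base a x
  move : ∀ a, G ⧸ H → X a
  move_smul : ∀ a x, ι a (move a x) • base a x = x
  move_base : ∀ a x, move a (base a x) = 1
  rep : G ⧸ H → G
  mk_rep : ∀ x, (rep x : G ⧸ H) = x
  rep_one : rep ((1 : G) : G ⧸ H) = 1
  induction : ∀ p : G ⧸ H → Prop, p ((1 : G) : G ⧸ H) →
    (∀ a x, rep x = ι a (move a x) * rep (base a x) → p (base a x) → p x) → ∀ x, p x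

/-- The points of `G ⧸ H` that can be reached from the trivial coset by `n` steps. -/
inductive Reach (ι : ∀ a, X a →ₜ* G) (H : Subgroup G) : ℕ → G ⧸ H → Prop
  | zero : Reach ι H 0 ((1 : G) : G ⧸ H)
  | step {n x} (a : A) (g : X a) : Reach ι H n x → Reach ι H (n + 1) (ι a g • x)

theorem Reach.exists_of_isOpen [IsTopologicalGroup G] {ι : ∀ a, X a →ₜ* G} {H : Subgroup G}
    (hH : IsOpen (H : Set G))
    (hι : ∀ S : Subgroup G, IsClosed (S : Set G) → (∀ a x, ι a x ∈ S) → S = ⊤) (x : G ⧸ H) :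
    ∃ n, Reach ι H n x := by
  have := QuotientGroup.discreteTopology hH
  -- The setwise stabilizer `S` of the reachable set is closed and contains all factors, hence is
  -- `G`, which acts transitively.
  let R : Set (G ⧸ H) := {x | ∃ n, Reach ι H n x}
  let S : Subgroup G :=
    { carrier := {g | ∀ x, g • x ∈ R ↔ x ∈ R}
      one_mem' := fun x => by rw [one_smul]
      mul_mem' := fun {g g'} hg hg' x => by rw [mul_smul, hg, hg']
      inv_mem' := fun {g} hg x => by rw [← hg, smul_inv_smul] }
  have hS : S = ⊤ := by
    refine hι S ?_ fun a g x => ⟨?_, ?_⟩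
    · have : (S : Set G) = ⋂ x : G ⧸ H, (fun g : G => g • x) ⁻¹' {y | y ∈ R ↔ x ∈ R} := by
        ext g; simp [S]
      rw [this]
      exact isClosed_iInter fun x => (isClosed_discrete _).preimage (by fun_prop)
    · rintro ⟨n, hn⟩
      refine ⟨n + 1, ?_⟩
      simpa [smul_smul, ← map_mul] using Reach.step a g⁻¹ hn
    · rintro ⟨n, hn⟩
      exact ⟨n + 1, .step a g hn⟩
  obtain ⟨g, rfl⟩ := QuotientGroup.mk_surjective x
  have hg : g ∈ S := hS ▸ Subgroup.mem_top g
  have := (hg ((1 : G) : G ⧸ H)).mpr ⟨0, .zero⟩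
  rwa [MulAction.Quotient.smul_coe, smul_eq_mul, mul_one] at this

/-- Let `d` be the distance to the trivial coset. Taking a point of minimal `d` as base point of
each orbit makes every nontrivial `x` have some factor whose base point is strictly closer; these
edges form the tree along which `rep` is defined by recursion on `d`. -/
theorem SchreierSystem.nonempty [IsTopologicalGroup G] {ι : ∀ a, X a →ₜ* G} {H : Subgroup G}
    (hH : IsOpen (H : Set G))
    (hι : ∀ S : Subgroup G, IsClosed (S : Set G) → (∀ a x, ι a x ∈ S) → S = ⊤) :
    Nonempty (SchreierSystem ι H) := by
  classical
  have hR := Reach.exists_of_isOpen hH hι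
  let o : G ⧸ H := ((1 : G) : G ⧸ H)
  let d : G ⧸ H → ℕ := fun x => Nat.find (hR x)
  have hd : ∀ x, x ≠ o → ∃ (a : A) (g : X a), d (ι a g • x) < d x := by
    intro x hx
    have h := Nat.find_spec (hR x)
    change Reach ι H (d x) x at h
    generalize hn : d x = n at h
    cases h with
    | zero => exact absurd rfl hx
    | @step n y a g h =>
      refine ⟨a, g⁻¹, ?_⟩
      rw [smul_smul, ← map_mul, inv_mul_cancel, map_one, one_smul]
      exact Nat.lt_succ_of_le (Nat.find_min' _ h)
  let O : A → G ⧸ H → Set (G ⧸ H) := fun a x => Set.range fun g : X a => ι a g • x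
  have hO : ∀ a x, (O a x).Nonempty := fun a x => Set.range_nonempty _
  -- The choice depends only on the orbit as a set, hence is constant along it.
  let base : A → G ⧸ H → G ⧸ H := fun a x => Function.argminOn d (O a x) (hO a x)
  have hO_smul : ∀ a g x, O a (ι a g • x) = O a x := by
    intro a g x
    ext y
    constructor
    · rintro ⟨k, rfl⟩
      exact ⟨k * g, by simp [mul_smul]⟩
    · rintro ⟨k, rfl⟩
      exact ⟨k * g⁻¹, by simp [smul_smul]⟩
  have hbase_smul : ∀ a g x, base a (ι a g • x) = base a x := by
    intro a g x
    simp only [base, hO_smul]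
  have hmem : ∀ a x, ∃ g : X a, ι a g • base a x = x := by
    intro a x
    obtain ⟨g, hg⟩ := Function.argminOn_mem d (O a x) (hO a x)
    refine ⟨g⁻¹, ?_⟩
    change ι a g⁻¹ • Function.argminOn d (O a x) (hO a x) = x
    rw [← hg]
    simp [smul_smul]
  have hbase_base : ∀ a x, base a (base a x) = base a x := by
    intro a x
    obtain ⟨g, hg⟩ := hmem a x
    conv_rhs => rw [← hg, hbase_smul]
  choose m hm using hmem
  -- At a base point, `m` could be a nontrivial stabilizer element, so the value is reset to `1`.
  let move : ∀ a, G ⧸ H → X a := fun a x => if base a x = x then 1 else m a x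
  have hmove : ∀ a x, ι a (move a x) • base a x = x := by
    intro a x
    by_cases h : base a x = x
    · simp [move, h]
    · simp [move, h, hm]
  have hpar : ∀ x, ∃ a : x ≠ o → A, ∀ h, d (base (a h) x) < d x := by
    intro x
    by_cases hx : x = o
    · exact ⟨fun h => absurd hx h, fun h => absurd hx h⟩
    · obtain ⟨a, g, h⟩ := hd x hx
      exact ⟨fun _ => a, fun _ => (Function.argminOn_le d (O a x) ⟨g, rfl⟩).trans_lt h⟩
  choose par hpar using hpar
  let rep : G ⧸ H → G := (measure d).wf.fix fun x r =>
    if h : x = o then 1 else ι (par x h) (move (par x h) x) * r (base (par x h) x) (hpar x h)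
  have hrep : ∀ x, rep x = if h : x = o then 1 else
      ι (par x h) (move (par x h) x) * rep (base (par x h) x) :=
    fun x => (measure d).wf.fix_eq _ x
  have hone : rep o = 1 := by rw [hrep, dif_pos rfl]
  have hstep : ∀ x (h : x ≠ o),
      rep x = ι (par x h) (move (par x h) x) * rep (base (par x h) x) :=
    fun x h => by rw [hrep x, dif_neg h]
  have hind : ∀ p : G ⧸ H → Prop, p o →
      (∀ a x, rep x = ι a (move a x) * rep (base a x) → p (base a x) → p x) → ∀ x, p x := by
    intro p h0 hs x
    induction x using (measure d).wf.induction with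
    | _ x ih =>
      by_cases hx : x = o
      · exact hx ▸ h0
      · exact hs _ x (hstep x hx) (ih _ (hpar x hx))
  refine ⟨⟨base, hbase_smul, move, hmove, ?_, rep, ?_, hone, hind⟩⟩
  · intro a x
    simp [move, hbase_base]
  · refine hind _ (by rw [hone]) fun a x h hx => ?_
    rw [h]
    conv_rhs => rw [← hmove a x, ← hx]
    rfl

end Schreier

/-! ### Homomorphisms on a subgroup as total functions. -/

section ExtendByOne

variable {G K : Type*} [Group G] [Group K] [TopologicalSpace G] [TopologicalSpace K]

open Classical in
/-- Extend a homomorphism defined on a subgroup by the value `1`. -/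
noncomputable def extendByOne {S : Subgroup G} (f : S →ₜ* K) (g : G) : K :=
  if h : g ∈ S then f ⟨g, h⟩ else 1

theorem extendByOne_of_mem {S : Subgroup G} (f : S →ₜ* K) {g : G} (h : g ∈ S) :
    extendByOne f g = f ⟨g, h⟩ :=
  dif_pos h

theorem extendByOne_one {S : Subgroup G} (f : S →ₜ* K) : extendByOne f 1 = 1 := by
  rw [extendByOne_of_mem f S.one_mem]
  exact map_one f

theorem extendByOne_mul {S : Subgroup G} (f : S →ₜ* K) {g g' : G} (h : g ∈ S) (h' : g' ∈ S) :
    extendByOne f (g * g') = extendByOne f g * extendByOne f g' := by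
  rw [extendByOne_of_mem f h, extendByOne_of_mem f h', extendByOne_of_mem f (S.mul_mem h h'),
    ← map_mul]
  rfl

theorem tendsto_extendByOne {S : Subgroup G} (f : S →ₜ* K) :
    Filter.Tendsto (extendByOne f) (nhdsWithin 1 S) (nhds 1) := by
  rw [nhdsWithin_eq_map_subtype_coe S.one_mem, Filter.tendsto_map'_iff]
  have h : extendByOne f ∘ Subtype.val = f := funext fun g => extendByOne_of_mem f g.2
  rw [show (extendByOne f ∘ fun x : (S : Set G) => (x : G)) = f from h]
  have := f.continuous_toFun.tendsto (1 : S)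
  rwa [show f.toFun 1 = 1 from map_one f] at this

end ExtendByOne

theorem inv_section_smul_mul_mem {G : Type*} [Group G] {H : Subgroup G} {s : G ⧸ H → G} (hs : ∀ x, (s x : G ⧸ H) = x) (g : G) (x : G ⧸ H) :
    (s (g • x))⁻¹ * g * s x ∈ H := by
  rw [mul_assoc]
  refine QuotientGroup.eq.mp ?_
  rw [hs]
  conv_lhs => rw [← hs x]
  rfl

/-! ### Double coset representatives and loops. -/

namespace SchreierSystem

variable {A : Type v} {X : A → Type u} [∀ a, Group (X a)] [∀ a, TopologicalSpace (X a)]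
  {G : Type u} [Group G] [TopologicalSpace G] {ι : ∀ a, X a →ₜ* G} {H : Subgroup G}
  (σ : SchreierSystem ι H)

/-- The representatives of the double cosets of `H` and the image of `X a` which belong to the
base points. -/
def reps (a : A) : Set G := Set.range fun x => (σ.rep (σ.base a x))⁻¹

/-- The double coset representative which belongs to the `X a`-orbit of `x`. -/
def index (a : A) (x : G ⧸ H) : Σ a, σ.reps a :=
  ⟨a, (σ.rep (σ.base a x))⁻¹, x, rfl⟩

/-- The coset representative of `x` obtained by moving that of the base point. -/
def cosetRep (a : A) (x : G ⧸ H) : G := ι a (σ.move a x) * σ.rep (σ.base a x)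

/-- The discrepancy of the two coset representatives of `x`. -/
def loop (a : A) (x : G ⧸ H) : G := (σ.rep x)⁻¹ * σ.cosetRep a x

theorem index_smul (a : A) (g : X a) (x : G ⧸ H) : σ.index a (ι a g • x) = σ.index a x := by
  simp only [index, base_smul]

theorem base_base (a : A) (x : G ⧸ H) : σ.base a (σ.base a x) = σ.base a x := by
  conv_rhs => rw [← σ.move_smul a x, σ.base_smul]

theorem cosetRep_base (a : A) (x : G ⧸ H) : σ.cosetRep a (σ.base a x) = σ.rep (σ.base a x) := by
  rw [cosetRep, base_base, move_base, map_one, one_mul]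

theorem mk_cosetRep (a : A) (x : G ⧸ H) : (σ.cosetRep a x : G ⧸ H) = x := by
  conv_rhs => rw [← σ.move_smul a x, ← σ.mk_rep (σ.base a x)]
  rfl

theorem smul_one_eq_rep (x : G ⧸ H) : σ.rep x • ((1 : G) : G ⧸ H) = x := by
  rw [MulAction.Quotient.smul_coe, smul_eq_mul, mul_one, mk_rep]

theorem loop_mem (a : A) (x : G ⧸ H) : σ.loop a x ∈ H :=
  QuotientGroup.eq.mp ((σ.mk_rep x).trans (σ.mk_cosetRep a x).symm)

theorem loop_base (a : A) (x : G ⧸ H) : σ.loop a (σ.base a x) = 1 := by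
  rw [loop, cosetRep_base, inv_mul_cancel]

/-- Both points have the same base point, so the element is a conjugate of an element of `ι a (X a)`
by `rep` of that base point; it lies in `H` because `cosetRep` is a section of `G → G ⧸ H`. -/
theorem mem_conjInter (a : A) (g : X a) (x : G ⧸ H) :
    (σ.cosetRep a (ι a g • x))⁻¹ * ι a g * σ.cosetRep a x ∈
      conjInter H (ι (σ.index a x).1).toMonoidHom.range ((σ.index a x).2 : G) := by
  refine ⟨⟨_, ⟨(σ.move a (ι a g • x))⁻¹ * g * σ.move a x, rfl⟩, ?_⟩,
    inv_section_smul_mul_mem (σ.mk_cosetRep a) _ _⟩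
  change (σ.rep (σ.base a x))⁻¹ * ι a ((σ.move a (ι a g • x))⁻¹ * g * σ.move a x) *
    ((σ.rep (σ.base a x))⁻¹)⁻¹ = _
  simp only [cosetRep, base_smul, map_mul, map_inv]
  group

/-- Inversion turns the double cosets into the `X a`-orbits on `G ⧸ H`, which correspond to their
base points; hence the inverses in `reps`. -/
theorem isDoubleCosetReps (a : A) : IsDoubleCosetReps H (ι a).toMonoidHom.range (σ.reps a) := by
  intro g
  refine ⟨(σ.rep (σ.base a ((g⁻¹ : G) : G ⧸ H)))⁻¹, ⟨⟨_, rfl⟩, ?_⟩, ?_⟩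
  · rw [DoubleCoset.mem_doubleCoset]
    have h := σ.mk_cosetRep a ((g⁻¹ : G) : G ⧸ H)
    refine ⟨(σ.cosetRep a ((g⁻¹ : G) : G ⧸ H))⁻¹ * g⁻¹, QuotientGroup.eq.mp h,
      ι a (σ.move a ((g⁻¹ : G) : G ⧸ H)), ⟨_, rfl⟩, ?_⟩
    rw [cosetRep]
    group
  · rintro _ ⟨⟨x, rfl⟩, hx⟩
    obtain ⟨h, hh, _, ⟨k, rfl⟩, e⟩ := DoubleCoset.mem_doubleCoset.mp hx
    have e' : σ.rep (σ.base a x) = ι a k⁻¹ * (g⁻¹ * h⁻¹) := by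
      rw [← inv_inv (σ.rep (σ.base a x))]
      change ((σ.rep (σ.base a x))⁻¹)⁻¹ = _
      have e'' : (σ.rep (σ.base a x))⁻¹ = h * g * ι a k := e
      rw [e'', map_inv]
      group
    have e₂ : σ.base a x = ι a k⁻¹ • ((g⁻¹ : G) : G ⧸ H) := by
      rw [← σ.mk_rep (σ.base a x), e', MulAction.Quotient.smul_coe, smul_eq_mul]
      refine QuotientGroup.eq.mpr ?_
      convert SetLike.mem_coe.mp hh using 1
      group
    have e₃ : σ.base a x = σ.base a ((g⁻¹ : G) : G ⧸ H) := by
      rw [← σ.base_base a x, e₂, σ.base_smul]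
    change (σ.rep (σ.base a x))⁻¹ = _
    rw [e₃]

theorem finite_reps [Finite (G ⧸ H)] (a : A) : (σ.reps a).Finite := Set.finite_range _

end SchreierSystem

/-! ### Consequences of convergence. -/

section Finiteness

variable {A : Type v} {X : A → Type u} [∀ a, Group (X a)] [∀ a, TopologicalSpace (X a)]
  {G : Type u} [Group G] [TopologicalSpace G] {ι : ∀ a, X a →ₜ* G} {H : Subgroup G}

/-- The pointwise stabilizer of the finite discrete space `G ⧸ H` is an open neighbourhood of `1`.
-/
theorem finite_not_trivial_smul [IsTopologicalGroup G] [DiscreteTopology (G ⧸ H)] [Finite (G ⧸ H)]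
    (hι : IsConvergent ι) : {a | ¬ ∀ (g : X a) (x : G ⧸ H), ι a g • x = x}.Finite := by
  refine (hι (⋂ x : G ⧸ H, (fun g : G => g • x) ⁻¹' {x})
    (isOpen_iInter_of_finite fun x => (isOpen_discrete _).preimage (by fun_prop))
    (by simp)).subset fun a ha h => ha fun g x => ?_
  exact Set.mem_iInter.mp (h ⟨g, rfl⟩) x

namespace SchreierSystem

variable (σ : SchreierSystem ι H)

theorem base_eq_of_trivial {a : A} (h : ∀ (g : X a) (x : G ⧸ H), ι a g • x = x) (x : G ⧸ H) :
    σ.base a x = x := by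
  conv_rhs => rw [← σ.move_smul a x, h]

theorem finite_loop_ne_one [IsTopologicalGroup G] [DiscreteTopology (G ⧸ H)] [Finite (G ⧸ H)]
    (hι : IsConvergent ι) : {p : A × (G ⧸ H) | σ.loop p.1 p.2 ≠ 1}.Finite := by
  refine ((finite_not_trivial_smul (H := H) hι).prod (Set.finite_univ (α := G ⧸ H))).subset ?_
  rintro ⟨a, x⟩ hp
  refine ⟨fun h => hp ?_, trivial⟩
  change σ.loop a x = 1
  rw [← σ.base_eq_of_trivial h x, loop_base]

theorem isConvergent_inclusion [IsTopologicalGroup G] [Finite (G ⧸ H)] (hι : IsConvergent ι) :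
    IsConvergent (fun i : Σ a, σ.reps a =>
      inclusion (conjInter_le H (ι i.1).toMonoidHom.range (i.2 : G))) := by
  intro U hU h1
  obtain ⟨V, hV, rfl⟩ := isOpen_induced_iff.mp hU
  -- Only finitely many conjugators `rep x` occur, so one neighbourhood serves them all.
  have hfin := hι (⋂ x : G ⧸ H, (fun g : G => (σ.rep x)⁻¹ * g * σ.rep x) ⁻¹' V)
    (isOpen_iInter_of_finite fun x => hV.preimage (by fun_prop))
    (by simpa using h1)
  refine (hfin.biUnion (t := fun a => Set.range (Sigma.mk (β := fun a => σ.reps a) a))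
    fun a _ => ?_).subset ?_
  · have := (σ.finite_reps a).to_subtype
    exact Set.finite_range _
  · rintro ⟨a, _, x, rfl⟩ hi
    refine Set.mem_biUnion (x := a) (fun h => hi ?_) ⟨_, rfl⟩
    rintro _ ⟨⟨_, ⟨_, ⟨k, rfl⟩, rfl⟩, _⟩, rfl⟩
    have := Set.mem_iInter.mp (h ⟨k, rfl⟩) (σ.base a x)
    change (σ.rep (σ.base a x))⁻¹ * ι a k * ((σ.rep (σ.base a x))⁻¹)⁻¹ ∈ V
    rwa [inv_inv]

end SchreierSystem

end Finiteness

/-! ### Homomorphisms on `H` and cocycles: uniqueness and existence. -/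

namespace SchreierSystem

variable {A : Type v} {X : A → Type u} [∀ a, Group (X a)] [∀ a, TopologicalSpace (X a)]
  {G : Type u} [Group G] [TopologicalSpace G] {ι : ∀ a, X a →ₜ* G} {H : Subgroup G}
  {K : Type u} [Group K] [TopologicalSpace K]

/-- The section of the projection to `G` induced by a homomorphism on `H`. -/
def inducedSection [IsTopologicalGroup G] [DiscreteTopology (G ⧸ H)]
    (σ : SchreierSystem ι H) (φ : H →ₜ* K) : G →ₜ* CocycleGroup (G ⧸ H) K G where
  toFun g := (fun x => φ ⟨(σ.rep (g • x))⁻¹ * g * σ.rep x,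
    inv_section_smul_mul_mem σ.mk_rep g x⟩, g)
  map_one' := by
    refine Prod.ext (funext fun x => ?_) rfl
    refine (congrArg φ (Subtype.ext ?_)).trans (map_one φ)
    simp
  map_mul' g g' := by
    refine Prod.ext (funext fun x => ?_) rfl
    refine (congrArg φ (Subtype.ext ?_)).trans (map_mul φ _ _)
    simp only [Subgroup.coe_mul, mul_smul]
    group
  continuous_toFun := by
    refine Continuous.prodMk (continuous_pi fun x => φ.continuous_toFun.comp ?_) continuous_id
    refine Continuous.subtype_mk ?_ _
    have : Continuous fun g : G => σ.rep (g • x) :=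
      (continuous_of_discreteTopology (f := σ.rep)).comp (by fun_prop)
    fun_prop

variable {C : ∀ (G : Type u) [Group G], Prop} (σ : SchreierSystem ι H)

/-- The induced sections agree on each factor, since the Schreier elements of a factor are products
of loops and elements of the conjugate intersections. So they agree on `G`, and evaluation at the
trivial coset, where `rep` is `1`, recovers `φ` and `φ'`. -/
theorem hom_ext (hC : IsExtensionClosedVariety C) (hι : IsFreeProduct C ι)
    (hH : IsOpen (H : Set G)) (hK : IsProC C K) {φ φ' : H →ₜ* K}
    (hconj : ∀ (i : Σ a, σ.reps a) (g : conjInter H (ι i.1).toMonoidHom.range (i.2 : G)),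
      φ (inclusion (conjInter_le _ _ _) g) = φ' (inclusion (conjInter_le _ _ _) g))
    (hloop : ∀ a x, φ ⟨σ.loop a x, σ.loop_mem a x⟩ = φ' ⟨σ.loop a x, σ.loop_mem a x⟩) :
    φ = φ' := by
  have := hι.isProC.isTopologicalGroup
  have := hι.isProC.compactSpace
  have := QuotientGroup.discreteTopology hH
  have : Finite (G ⧸ H) := finite_of_compact_of_discrete
  have key : σ.inducedSection φ = σ.inducedSection φ' := by
    refine hι.hom_ext (hK.cocycleGroup hC hι.isProC) fun a g => Prod.ext (funext fun x => ?_) rfl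
    have e : (⟨(σ.rep (ι a g • x))⁻¹ * ι a g * σ.rep x,
        inv_section_smul_mul_mem σ.mk_rep (ι a g) x⟩ : H) =
        ⟨σ.loop a (ι a g • x), σ.loop_mem a _⟩ *
          inclusion (conjInter_le _ _ _) ⟨_, σ.mem_conjInter a g x⟩ *
          ⟨σ.loop a x, σ.loop_mem a _⟩⁻¹ := by
      ext
      change _ = σ.loop a (ι a g • x) * ((σ.cosetRep a (ι a g • x))⁻¹ * ι a g * σ.cosetRep a x) *
        (σ.loop a x)⁻¹
      simp only [loop]
      group
    change φ _ = φ' _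
    rw [e]
    simp only [map_mul, map_inv, hloop, hconj]
  refine ContinuousMonoidHom.ext fun h => ?_
  have h2 := congrFun (congrArg Prod.fst (DFunLike.congr_fun key (h : G))) ((1 : G) : G ⧸ H)
  have e : ∀ p, (⟨(σ.rep ((h : G) • ((1 : G) : G ⧸ H)))⁻¹ * h * σ.rep ((1 : G) : G ⧸ H), p⟩ : H)
      = h := by
    intro p
    have : (h : G) • ((1 : G) : G ⧸ H) = ((1 : G) : G ⧸ H) := by
      rw [MulAction.Quotient.smul_coe, smul_eq_mul, mul_one]
      exact QuotientGroup.eq.mpr (by simp)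
    ext
    simp [this, σ.rep_one]
  change φ _ = φ' _ at h2
  rwa [e] at h2

section Lift

variable (f : ∀ i : Σ a, σ.reps a, conjInter H (ι i.1).toMonoidHom.range (i.2 : G) →ₜ* K)
  (κ : A → G ⧸ H → K)

/-- The cocycle on `X a` with prescribed values on the stabilizers of the base points and on the
elements `move a x`. -/
noncomputable def cocycle (a : A) (g : X a) (x : G ⧸ H) : K :=
  κ a (ι a g • x) * extendByOne (f (σ.index a x))
    ((σ.cosetRep a (ι a g • x))⁻¹ * ι a g * σ.cosetRep a x) * (κ a x)⁻¹

theorem cocycle_one (a : A) (x : G ⧸ H) : σ.cocycle f κ a 1 x = 1 := by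
  rw [cocycle, map_one, one_smul, mul_one, inv_mul_cancel, extendByOne_one, mul_one,
    mul_inv_cancel]

theorem cocycle_mul (a : A) (g g' : X a) (x : G ⧸ H) :
    σ.cocycle f κ a (g * g') x = σ.cocycle f κ a g (ι a g' • x) * σ.cocycle f κ a g' x := by
  have e : (σ.cosetRep a (ι a (g * g') • x))⁻¹ * ι a (g * g') * σ.cosetRep a x =
      ((σ.cosetRep a (ι a g • ι a g' • x))⁻¹ * ι a g * σ.cosetRep a (ι a g' • x)) *
        ((σ.cosetRep a (ι a g' • x))⁻¹ * ι a g' * σ.cosetRep a x) := by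
    rw [map_mul, mul_smul]
    group
  -- As `extendByOne` takes its argument in `G` rather than in the subgroup, the index can be
  -- rewritten along the orbit without transporting membership proofs.
  have h := σ.mem_conjInter a g (ι a g' • x)
  rw [index_smul] at h
  simp only [cocycle, e]
  rw [extendByOne_mul _ h (σ.mem_conjInter a g' x), index_smul, map_mul, mul_smul]
  group

theorem cocycle_move (hκ : ∀ a x, σ.loop a x = 1 → κ a x = 1) (a : A) (x : G ⧸ H) :
    σ.cocycle f κ a (σ.move a x) (σ.base a x) = κ a x := by
  have e : (σ.cosetRep a x)⁻¹ * ι a (σ.move a x) * σ.cosetRep a (σ.base a x) = 1 := by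
    rw [cosetRep_base, cosetRep]
    group
  rw [cocycle, move_smul, e, extendByOne_one, hκ a _ (σ.loop_base a x), inv_one, mul_one, mul_one]

theorem cocycle_of_smul_base_eq (hκ : ∀ a x, σ.loop a x = 1 → κ a x = 1) (a : A) (g : X a)
    (x : G ⧸ H) (hg : ι a g • σ.base a x = σ.base a x) :
    σ.cocycle f κ a g (σ.base a x) = extendByOne (f (σ.index a x))
      ((σ.rep (σ.base a x))⁻¹ * ι a g * σ.rep (σ.base a x)) := by
  have e : σ.index a (σ.base a x) = σ.index a x := by
    conv_rhs => rw [← σ.move_smul a x, σ.index_smul]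
  rw [cocycle, hg, cosetRep_base, hκ a _ (σ.loop_base a x), inv_one, one_mul, mul_one, e]

/-- When the action is trivial every point is a base point, so all `κ a x` are `1` and only values
of `f` remain. This gives convergence of the cocycles. -/
theorem cocycle_mem_of_trivial (hκ : ∀ a x, σ.loop a x = 1 → κ a x = 1) {a : A}
    (ht : ∀ (g : X a) (x : G ⧸ H), ι a g • x = x) {V : Set K}
    (hV : ∀ x, Set.range (f (σ.index a x)) ⊆ V) (g : X a) (x : G ⧸ H) :
    σ.cocycle f κ a g x ∈ V := by
  have hk : κ a x = 1 := hκ a x (by rw [← σ.base_eq_of_trivial ht x, loop_base])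
  have h := σ.mem_conjInter a g x
  rw [cocycle]
  rw [ht] at h ⊢
  rw [hk, one_mul, inv_one, mul_one, extendByOne_of_mem _ h]
  exact hV x ⟨_, rfl⟩

variable [IsTopologicalGroup G] [DiscreteTopology (G ⧸ H)] [IsTopologicalGroup K]

theorem tendsto_cocycle [∀ a, IsTopologicalGroup (X a)] (a : A) (x : G ⧸ H) :
    Filter.Tendsto (fun g => σ.cocycle f κ a g x) (nhds 1) (nhds 1) := by
  -- Near `1` the point `x` is fixed, so the cocycle is a conjugate by `κ a x` of a value of `f`.
  have hs : ∀ᶠ g in nhds (1 : X a), ι a g • x = x := by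
    have hc : Continuous fun g : X a => ι a g • x := (ι a).continuous_toFun.smul continuous_const
    refine hc.continuousAt.eventually (p := fun z => z = x) ?_
    simp
  have h1 : Filter.Tendsto (fun g : X a => (σ.cosetRep a x)⁻¹ * ι a g * σ.cosetRep a x)
      (nhds 1) (nhdsWithin 1
        (conjInter H (ι (σ.index a x).1).toMonoidHom.range ((σ.index a x).2 : G))) := by
    refine tendsto_nhdsWithin_iff.mpr ⟨?_, ?_⟩
    · have hc : Continuous fun g : X a => (σ.cosetRep a x)⁻¹ * ι a g * σ.cosetRep a x :=
        (continuous_const.mul (ι a).continuous_toFun).mul continuous_const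
      simpa using hc.tendsto 1
    · filter_upwards [hs] with g hg
      have := σ.mem_conjInter a g x
      rwa [hg] at this
  have h2 := ((tendsto_extendByOne (f (σ.index a x))).comp h1).const_mul (κ a x)
    |>.mul_const (κ a x)⁻¹
  rw [mul_one, mul_inv_cancel] at h2
  refine h2.congr' ?_
  filter_upwards [hs] with g hg
  simp [cocycle, hg]

/-- The homomorphism which corresponds to the cocycle on `X a`. -/
noncomputable def cocycleHom [∀ a, IsTopologicalGroup (X a)] (a : A) :
    X a →ₜ* CocycleGroup (G ⧸ H) K G :=
  let c : X a →* CocycleGroup (G ⧸ H) K G :=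
    { toFun := fun g => (σ.cocycle f κ a g, ι a g)
      map_one' := Prod.ext (funext fun x => σ.cocycle_one f κ a x) (map_one _)
      map_mul' := fun g g' =>
        Prod.ext (funext fun x => σ.cocycle_mul f κ a g g' x) (map_mul _ _ _) }
  { toMonoidHom := c
    continuous_toFun := by
      refine continuous_of_continuousAt_one c (ContinuousAt.prodMk (f := σ.cocycle f κ a) ?_
        (ι a).continuous_toFun.continuousAt)
      refine continuousAt_pi.mpr fun x => ?_
      have := σ.tendsto_cocycle f κ a x
      rwa [← σ.cocycle_one f κ a x] at this }

theorem isConvergent_cocycleHom [∀ a, IsTopologicalGroup (X a)] [Finite (G ⧸ H)]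
    (hκ : ∀ a x, σ.loop a x = 1 → κ a x = 1) (hι : IsConvergent ι) (hf : IsConvergent f) :
    IsConvergent (σ.cocycleHom f κ) := by
  intro U hU h1
  obtain ⟨U₁, U₂, hU₁, hU₂, h₁, h₂, hU₁₂⟩ := isOpen_prod_iff.mp hU 1 1 h1
  obtain ⟨V, hV, hV1, hVU⟩ := exists_isOpen_pi_subset hU₁ h₁
  refine (((finite_not_trivial_smul (H := H) hι).union (hι U₂ hU₂ h₂)).union
    ((hf V hV hV1).image Sigma.fst)).subset ?_
  intro a ha
  by_contra hn
  simp only [Set.mem_union, Set.mem_ofPred_eq, not_or, not_not] at hn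
  obtain ⟨⟨ht, h2⟩, h3⟩ := hn
  refine ha ?_
  rintro _ ⟨g, rfl⟩
  refine hU₁₂ ⟨hVU _ (σ.cocycle_mem_of_trivial f κ hκ ht (fun x => ?_) g), h2 ⟨g, rfl⟩⟩
  by_contra hx
  exact h3 ⟨σ.index a x, hx, rfl⟩

end Lift

/-- The prescribed data define cocycles on the factors, which glue to a cocycle `c` on `G`; its
restriction at the trivial coset is `φ`. The condition `hκ` covers both tree edges and base points.
-/
theorem exists_lift (hC : IsExtensionClosedVariety C) (hι : IsFreeProduct C ι)
    (hH : IsOpen (H : Set G)) (hK : IsProC C K)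
    (f : ∀ i : Σ a, σ.reps a, conjInter H (ι i.1).toMonoidHom.range (i.2 : G) →ₜ* K)
    (hf : IsConvergent f) (κ : A → G ⧸ H → K) (hκ : ∀ a x, σ.loop a x = 1 → κ a x = 1) :
    ∃ φ : H →ₜ* K, (∀ i g, φ (inclusion (conjInter_le _ _ _) g) = f i g) ∧
      ∀ a x, φ ⟨σ.loop a x, σ.loop_mem a x⟩ = κ a x := by
  have := hι.isProC.isTopologicalGroup
  have := hι.isProC.compactSpace
  have := hK.isTopologicalGroup
  have := fun a => (hι.isProC_factor a).isTopologicalGroup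
  have := QuotientGroup.discreteTopology hH
  have : Finite (G ⧸ H) := finite_of_compact_of_discrete
  obtain ⟨l, hl, -⟩ := hι.existsUnique_lift _ (hK.cocycleGroup (E := G ⧸ H) hC hι.isProC)
    (σ.cocycleHom f κ) (σ.isConvergent_cocycleHom f κ hκ hι.convergent hf)
  have hsnd : ∀ g, (l g).2 = g := by
    let p : CocycleGroup (G ⧸ H) K G →ₜ* G :=
      { toMonoidHom := CocycleGroup.snd, continuous_toFun := CocycleGroup.continuous_snd }
    have : p.comp l = ContinuousMonoidHom.id G := hι.hom_ext hι.isProC fun a x => by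
      change (l (ι a x)).2 = ι a x
      rw [hl]; rfl
    exact DFunLike.congr_fun this
  let o : G ⧸ H := ((1 : G) : G ⧸ H)
  let c : G → G ⧸ H → K := fun g => (l g).1
  have c_mul : ∀ g g' x, c (g * g') x = c g (g' • x) * c g' x := by
    intro g g' x
    simp only [c]
    rw [map_mul, CocycleGroup.mul_fst, hsnd]
  have c_one : ∀ x, c 1 x = 1 := by
    intro x
    simp only [c]
    rw [map_one, CocycleGroup.one_fst]
  have c_ι : ∀ a g x, c (ι a g) x = σ.cocycle f κ a g x := by
    intro a g x
    simp only [c]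
    rw [hl]; rfl
  -- Induction along the tree: a tree edge has trivial loop, so `κ`, and with it `c`, is `1` there.
  have hrep : ∀ x, c (σ.rep x) o = 1 := by
    refine σ.induction _ ?_ fun a x hx ih => ?_
    · rw [σ.rep_one, c_one]
    · have h1 : σ.loop a x = 1 := by rw [loop, cosetRep, hx, inv_mul_cancel]
      rw [hx, c_mul, ih, σ.smul_one_eq_rep, c_ι, σ.cocycle_move f κ hκ, hκ a x h1, mul_one]
  have hinv : ∀ x, c (σ.rep x)⁻¹ x = 1 := by
    intro x
    have := c_mul (σ.rep x)⁻¹ (σ.rep x) o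
    rwa [inv_mul_cancel, c_one, hrep, σ.smul_one_eq_rep, mul_one, eq_comm] at this
  -- Since `c` is trivial on representatives, its value at any point can be read off at the trivial
  -- coset.
  have hconj : ∀ g x y, g • x = y → c ((σ.rep y)⁻¹ * g * σ.rep x) o = c g x := by
    rintro g x _ rfl
    rw [c_mul, c_mul, hrep, σ.smul_one_eq_rep, hinv, one_mul, mul_one]
  let φ : H →ₜ* K :=
    { toFun := fun h => c h o
      map_one' := c_one o
      map_mul' := fun h h' => by
        have : (h' : G) • o = o := by
          simp only [o]
          rw [MulAction.Quotient.smul_coe, smul_eq_mul, mul_one]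
          exact QuotientGroup.eq.mpr (by simp)
        rw [Subgroup.coe_mul, c_mul, this]
      continuous_toFun := by
        have h1 : Continuous c := continuous_fst.comp l.continuous_toFun
        exact ((continuous_apply o).comp h1).comp continuous_subtype_val }
  refine ⟨φ, ?_, fun a x => ?_⟩
  · rintro ⟨a, _, x, rfl⟩ ⟨_, ⟨⟨_, ⟨g, rfl⟩, rfl⟩, hgH⟩⟩
    have hgH' : (σ.rep (σ.base a x))⁻¹ * ι a g * ((σ.rep (σ.base a x))⁻¹)⁻¹ ∈ H := hgH
    have e : (ι a g) • σ.base a x = σ.base a x := by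
      rw [inv_inv, mul_assoc] at hgH'
      have := QuotientGroup.eq.mpr hgH'
      rw [σ.mk_rep] at this
      conv_rhs => rw [this]
      conv_lhs => rw [← σ.mk_rep (σ.base a x)]
      rfl
    have e₂ : (σ.rep (σ.base a x))⁻¹ * ι a g * ((σ.rep (σ.base a x))⁻¹)⁻¹ =
      (σ.rep (σ.base a x))⁻¹ * ι a g * σ.rep (σ.base a x) := by rw [inv_inv]
    change c ((σ.rep (σ.base a x))⁻¹ * ι a g * ((σ.rep (σ.base a x))⁻¹)⁻¹) o = _
    rw [e₂, hconj _ _ _ e, c_ι, σ.cocycle_of_smul_base_eq f κ hκ a g x e, ← e₂]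
    exact extendByOne_of_mem _ _
  · change c (σ.loop a x) o = _
    rw [loop, cosetRep, ← mul_assoc, hconj _ _ _ (σ.move_smul a x), c_ι, σ.cocycle_move f κ hκ]

end SchreierSystem

/-! ### Splitting the joint universal property into `P` and `Φ`. -/

section Internal

variable {C : ∀ (G : Type u) [Group G], Prop} {G : Type u} [Group G] [TopologicalSpace G]

/-- Two continuous homomorphisms on the closed subgroup generated by a set agree if they agree on
the set. -/
theorem hom_ext_of_topologicalClosure [IsTopologicalGroup G] {K : Type u} [Group K]
    [TopologicalSpace K] [T2Space K] {s : Set G} {P : Subgroup G}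
    (hP : P = (Subgroup.closure s).topologicalClosure) {l l' : P →ₜ* K}
    (h : ∀ x (_ : x ∈ s) (hxP : x ∈ P), l ⟨x, hxP⟩ = l' ⟨x, hxP⟩) : l = l' := by
  subst hP
  let E : Subgroup (Subgroup.closure s).topologicalClosure :=
    l.toMonoidHom.eqLocus l'.toMonoidHom
  have hE : IsClosed (E : Set (Subgroup.closure s).topologicalClosure) :=
    isClosed_eq l.continuous_toFun l'.continuous_toFun
  have hc : IsClosed ((E.map (Subgroup.subtype _) : Subgroup G) : Set G) := by
    rw [Subgroup.coe_map]
    exact (Subgroup.isClosed_topologicalClosure _).isClosedEmbedding_subtypeVal.isClosedMap _ hE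
  have hle : (Subgroup.closure s).topologicalClosure ≤ E.map (Subgroup.subtype _) := by
    refine Subgroup.topologicalClosure_minimal _ ((Subgroup.closure_le _).mpr fun x hx => ?_) hc
    have hx' := Subgroup.le_topologicalClosure _ (Subgroup.subset_closure hx)
    exact ⟨⟨x, hx'⟩, h x hx hx', rfl⟩
  refine ContinuousMonoidHom.ext fun x => ?_
  obtain ⟨y, hy, e⟩ := hle x.2
  rw [← Subtype.ext (a1 := y) (a2 := x) e]
  exact hy

/-- A subgroup which has the universal property of the free product of a family of subgroups and a
free group on finitely many elements is an internal free product. -/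
theorem exists_isInternalFreeProduct (hC : IsExtensionClosedVariety C) (hG : IsProC C G)
    {H : Subgroup G} (hH : IsClosed (H : Set G)) {I : Type v} {S : I → Subgroup G}
    (hSc : ∀ i, IsClosed (S i : Set G)) (hS : ∀ i, S i ≤ H)
    (hconv : IsConvergent fun i => inclusion (hS i)) {n : ℕ} (z : Fin n → H)
    (hext : ∀ (K : Type u) [Group K] [TopologicalSpace K], IsProC C K → ∀ φ φ' : H →ₜ* K,
      (∀ i g, φ (inclusion (hS i) g) = φ' (inclusion (hS i) g)) → (∀ k, φ (z k) = φ' (z k)) →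
      φ = φ')
    (hlift : ∀ (K : Type u) [Group K] [TopologicalSpace K], IsProC C K →
      ∀ f : ∀ i, S i →ₜ* K, IsConvergent f → ∀ κ : Fin n → K,
      ∃ φ : H →ₜ* K, (∀ i g, φ (inclusion (hS i) g) = f i g) ∧ ∀ k, φ (z k) = κ k) :
    ∃ P Φ : Subgroup G, IsInternalFreeProduct C P S ∧ IsFreeOfFiniteRank C Φ ∧
      IsInternalFreeProduct C H (fun b : Bool => cond b P Φ) := by
  have := hG.isTopologicalGroup
  obtain ⟨P, hPdef⟩ : ∃ P, P = (Subgroup.closure (⋃ i, (S i : Set G))).topologicalClosure :=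
    ⟨_, rfl⟩
  obtain ⟨Φ, hΦdef⟩ : ∃ Φ, Φ =
    (Subgroup.closure (Set.range fun k => (z k : G))).topologicalClosure := ⟨_, rfl⟩
  have hPc : IsClosed (P : Set G) := hPdef ▸ Subgroup.isClosed_topologicalClosure _
  have hΦc : IsClosed (Φ : Set G) := hΦdef ▸ Subgroup.isClosed_topologicalClosure _
  have hPC := hG.of_isClosed hC hPc
  have hΦC := hG.of_isClosed hC hΦc
  have hSP : ∀ i, S i ≤ P := fun i x hx => hPdef ▸ Subgroup.le_topologicalClosure _
    (Subgroup.subset_closure (Set.mem_iUnion_of_mem i hx))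
  have hzΦ : ∀ k, (z k : G) ∈ Φ := fun k => hΦdef ▸ Subgroup.le_topologicalClosure _
    (Subgroup.subset_closure ⟨k, rfl⟩)
  have hPH : P ≤ H := hPdef ▸ Subgroup.topologicalClosure_minimal _ ((Subgroup.closure_le _).mpr
    (Set.iUnion_subset fun i => hS i)) hH
  have hΦH : Φ ≤ H := hΦdef ▸ Subgroup.topologicalClosure_minimal _ ((Subgroup.closure_le _).mpr
    (by rintro _ ⟨k, rfl⟩; exact (z k).2)) hH
  have hPconv : IsConvergent fun i => inclusion (hSP i) := by
    intro U hU h1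
    obtain ⟨V, hV, rfl⟩ := isOpen_induced_iff.mp hU
    refine (hconv (Subtype.val ⁻¹' V) (hV.preimage continuous_subtype_val) h1).subset
      fun i hi h => hi ?_
    rintro _ ⟨x, rfl⟩
    exact h ⟨x, rfl⟩
  have hPext : ∀ (K : Type u) [Group K] [TopologicalSpace K], IsProC C K → ∀ l l' : P →ₜ* K,
      (∀ i g, l (inclusion (hSP i) g) = l' (inclusion (hSP i) g)) → l = l' := by
    intro K _ _ hK l l' h
    have := hK.t2Space
    refine hom_ext_of_topologicalClosure hPdef fun x hx hxP => ?_
    obtain ⟨i, hi⟩ := Set.mem_iUnion.mp hx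
    exact h i ⟨x, hi⟩
  have hΦext : ∀ (K : Type u) [Group K] [TopologicalSpace K], IsProC C K → ∀ l l' : Φ →ₜ* K,
      (∀ k, l ⟨z k, hzΦ k⟩ = l' ⟨z k, hzΦ k⟩) → l = l' := by
    intro K _ _ hK l l' h
    have := hK.t2Space
    refine hom_ext_of_topologicalClosure hΦdef ?_
    rintro _ ⟨k, rfl⟩ _
    exact h k
  refine ⟨P, Φ, ⟨hSP, hPC, fun i => hG.of_isClosed hC (hSc i), hPconv, fun K _ _ hK f hf => ?_⟩,
    ⟨n, fun k => ⟨z k, hzΦ k⟩, hΦC, continuous_of_discreteTopology, fun K _ _ hK s _ => ?_⟩,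
    fun b => by cases b; exacts [hΦH, hPH], hG.of_isClosed hC hH,
    fun b => by cases b; exacts [hΦC, hPC], fun U _ _ => Set.toFinite _, fun K _ _ hK f _ => ?_⟩
  -- To lift from `P` or from `Φ` alone, send the other kind of generators to `1`, lift to `H` and
  -- restrict.
  · obtain ⟨φ, hφ, -⟩ := hlift K hK f hf fun _ => 1
    refine ⟨φ.comp (inclusion hPH), fun i x => hφ i x, fun l hl => hPext K hK _ _ fun i g => ?_⟩
    exact (hl i g).trans (hφ i g).symm
  · obtain ⟨φ, -, hφ⟩ := hlift K hK (fun i => 1)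
      (fun U _ h1 => by
        refine Set.finite_empty.subset fun i hi => hi ?_
        rintro _ ⟨x, rfl⟩
        exact h1) s
    refine ⟨φ.comp (inclusion hΦH), fun k => hφ k, fun l hl => hΦext K hK _ _ fun k => ?_⟩
    exact (hl k).trans (hφ k).symm
  · let fP : P →ₜ* K := f true
    let fΦ : Φ →ₜ* K := f false
    have hf : IsConvergent fun i => fP.comp (inclusion (hSP i)) := hPconv.comp fP
    obtain ⟨φ, hφ, hφz⟩ := hlift K hK _ hf fun k => fΦ ⟨z k, hzΦ k⟩
    have h1 : φ.comp (inclusion hPH) = fP := hPext K hK _ _ hφ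
    have h2 : φ.comp (inclusion hΦH) = fΦ := hΦext K hK _ _ hφz
    refine ⟨φ, fun b x => ?_, fun l hl => hext K hK _ _ (fun i g => ?_) fun k => ?_⟩
    · cases b
      · exact DFunLike.congr_fun h2 x
      · exact DFunLike.congr_fun h1 x
    · exact (hl true (inclusion (hSP i) g)).trans (hφ i g).symm
    · exact (hl false ⟨z k, hzΦ k⟩).trans (hφz k).symm

end Internal

end ProC

/-! ### The subgroup theorem. -/

theorem mainTheorem5
    (C : ∀ (G : Type u) [Group G], Prop) (hC : ProC.IsExtensionClosedVariety C)
    {A : Type v} (X : A → Type u) [∀ a, Group (X a)] [∀ a, TopologicalSpace (X a)]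
    (Γ : Type u) [Group Γ] [TopologicalSpace Γ]
    (ι : ∀ a, X a →ₜ* Γ) (hΓ : ProC.IsFreeProduct C ι)
    (H : Subgroup Γ) (hH : IsOpen (H : Set Γ)) :
    ∃ D : A → Set Γ,
      (∀ a, ProC.IsDoubleCosetReps H (ι a).toMonoidHom.range (D a)) ∧
      ProC.IsConvergent (fun i : Σ a, D a =>
        ProC.inclusion (ProC.conjInter_le H (ι i.1).toMonoidHom.range (i.2 : Γ))) ∧
      ∃ P Φ : Subgroup Γ,
        ProC.IsInternalFreeProduct C P (fun i : Σ a, D a =>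
          ProC.conjInter H (ι i.1).toMonoidHom.range (i.2 : Γ)) ∧
        ProC.IsFreeOfFiniteRank C Φ ∧
        ProC.IsInternalFreeProduct C H (fun b : Bool => cond b P Φ) := by
  have := hΓ.isProC.isTopologicalGroup
  have := hΓ.isProC.compactSpace
  have := hΓ.isProC.t2Space
  have := QuotientGroup.discreteTopology hH
  have : Finite (Γ ⧸ H) := finite_of_compact_of_discrete
  have hHc : IsClosed (H : Set Γ) := H.isClosed_of_isOpen hH
  obtain ⟨σ⟩ := ProC.SchreierSystem.nonempty hH fun S hS h => hΓ.eq_top_of_isClosed hC hS h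
  have hconv := σ.isConvergent_inclusion hΓ.convergent
  refine ⟨σ.reps, σ.isDoubleCosetReps, hconv, ?_⟩
  have := (σ.finite_loop_ne_one hΓ.convergent).to_subtype
  -- The free generators are indexed by the pairs with nontrivial loop.
  obtain ⟨n, ⟨e⟩⟩ := Finite.exists_equiv_fin {p : A × (Γ ⧸ H) | σ.loop p.1 p.2 ≠ 1}
  refine ProC.exists_isInternalFreeProduct hC hΓ.isProC hHc (fun i => ?_)
    (fun i => ProC.conjInter_le _ _ _) hconv
    (fun k => ⟨σ.loop (e.symm k).1.1 (e.symm k).1.2, σ.loop_mem _ _⟩) ?_ ?_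
  · have := (hΓ.isProC_factor i.1).compactSpace
    refine IsClosed.inter (IsCompact.isClosed ?_) hHc
    exact ((isCompact_range (ι i.1).continuous_toFun)).image
      (f := fun g => (i.2 : Γ) * g * (i.2 : Γ)⁻¹) (by fun_prop)
  · intro K _ _ hK φ φ' h1 h2
    refine σ.hom_ext hC hΓ hH hK h1 fun a x => ?_
    by_cases h : σ.loop a x = 1
    · have h' : (⟨σ.loop a x, σ.loop_mem a x⟩ : H) = 1 := Subtype.ext h
      rw [h', map_one, map_one]
    · have := h2 (e ⟨(a, x), h⟩)
      simpa using this
  · intro K _ _ hK f hf κ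
    classical
    obtain ⟨φ, h1, h2⟩ := σ.exists_lift hC hΓ hH hK f hf
      (fun a x => if h : σ.loop a x ≠ 1 then κ (e ⟨(a, x), h⟩) else 1)
      (fun a x h => dif_neg (not_not.mpr h))
    refine ⟨φ, h1, fun k => ?_⟩
    have hk : σ.loop (e.symm k).1.1 (e.symm k).1.2 ≠ 1 := (e.symm k).2
    rw [h2, dif_pos hk]
    exact congrArg κ (e.apply_symm_apply k)
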